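/- Let $k$ be an algebraically closed field, let $S=k[[\alpha_1,\dots,\alpha_n]]$ with maximal ideal $\mathfrak m$, and let $P\subset \operatorname{Hom}_k(S,k)$ be the space of functionals vanishing on $\mathfrak m^D$ for all $D\gg 0$. It has as basis the divided power monomials $x^{[\mathbf a]}$, $\mathbf a\in\mathbb{Z}_{\ge 0}^n$, dual to the monomials $\alpha^{\mathbf a}$; the monomial $x^{[\mathbf a]}$ has degree $\sum_i a_i$. For $f\in P$ let $f_{\ge e}$ denote the sum of the terms of $f$ of degree at least $e$. The ring $S$ acts on $P$ by contraction, $(\sigma\lrcorner f)(\tau)=f(\tau\sigma)$, and one puts $\operatorname{Ann}(f)=\{\sigma\in S : \sigma\lrcorner f=0\}$ and $\operatorname{Apolar}(f)=S/\operatorname{Ann}(f)$. A local $k$-algebra $A=S/I$ with maximal ideal $\mathfrak m_A$ and socle degree $s=\max\{i : \mathfrak m_A^i\neq 0\}$ is called compressed if $$\dim_k \mathfrak m_A^i/\mathfrak m_A^{i+1}=\min\left(\binom{i+n-1}{i},\binom{s-i+n-1}{s-i}\right)\qquad\text{for all } 0\le i\le s.$$ Let $f\in P$ have degree $d\ge 3$,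 and assume that the characteristic of $k$ is $0$ or greater than $d$. If $\operatorname{Apolar}(f)$ is compressed, then there is an isomorphism of $k$-algebras $$\operatorname{Apolar}(f)\simeq \operatorname{Apolar}\bigl(f_{\ge \lfloor d/2\rfloor+2}\bigr).$$ -/

import Mathlib

noncomputable section

namespace Apolarity

/-- The power series ring `S = k[[α₁, …, αₙ]]`. -/
abbrev PS (k : Type*) [Field k] (n : ℕ) : Type _ := MvPowerSeries (Fin n) k

/-- The maximal ideal `𝔪` of `S`. -/
abbrev mm (k : Type*) [Field k] (n : ℕ) : Ideal (PS k n) :=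
  IsLocalRing.maximalIdeal (PS k n)

/-- The divided power module `P ⊆ Hom_k(S, k)`: the functionals `f` that vanish on `𝔪 ^ D` for
all sufficiently large `D`.  The pairing `⟨σ, f⟩` of `σ : S` with `f : P` is `f.1 σ`. -/
def DP (k : Type*) [Field k] (n : ℕ) : Submodule k (Module.Dual k (PS k n)) where
  carrier := {f | ∃ D₀ : ℕ, ∀ D ≥ D₀, ∀ σ ∈ mm k n ^ D, f σ = 0}
  zero_mem' := ⟨0, fun _ _ _ _ => rfl⟩
  add_mem' := by
    rintro f g ⟨D₁, h₁⟩ ⟨D₂, h₂⟩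
    refine ⟨max D₁ D₂, fun D hD σ hσ => ?_⟩
    rw [LinearMap.add_apply, h₁ D (le_trans (le_max_left _ _) hD) σ hσ,
      h₂ D (le_trans (le_max_right _ _) hD) σ hσ, add_zero]
  smul_mem' := by
    rintro c f ⟨D₁, h₁⟩
    refine ⟨D₁, fun D hD σ hσ => ?_⟩
    rw [LinearMap.smul_apply, h₁ D hD σ hσ, smul_zero]

variable {k : Type*} [Field k] {n : ℕ}

/-- Contraction `σ ⌟ f`, determined by `⟨τ, σ ⌟ f⟩ = ⟨τ σ, f⟩` for all `τ : S`. -/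
def contract (σ : PS k n) (f : DP k n) : DP k n :=
  ⟨f.1.comp (LinearMap.mulRight k σ), by
    obtain ⟨D₀, h⟩ := f.2
    exact ⟨D₀, fun D hD τ hτ => h D hD _ (Ideal.mul_mem_right _ _ hτ)⟩⟩

theorem contract_apply (σ τ : PS k n) (f : DP k n) : (contract σ f).1 τ = f.1 (τ * σ) := rfl

/-- The apolar ideal `Ann(f) = {σ ∈ S | σ ⌟ f = 0}`. -/
def Ann (f : DP k n) : Ideal (PS k n) where
  carrier := {σ | contract σ f = 0}
  zero_mem' := by
    apply Subtype.ext
    apply LinearMap.ext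
    intro τ
    simp [contract_apply]
  add_mem' := by
    intro σ₁ σ₂ h₁ h₂
    apply Subtype.ext
    apply LinearMap.ext
    intro τ
    have e₁ : f.1 (τ * σ₁) = 0 := by
      rw [← contract_apply, show contract σ₁ f = 0 from h₁]; rfl
    have e₂ : f.1 (τ * σ₂) = 0 := by
      rw [← contract_apply, show contract σ₂ f = 0 from h₂]; rfl
    rw [contract_apply, mul_add, map_add, e₁, e₂, add_zero]; rfl
  smul_mem' := by
    intro ρ σ h
    apply Subtype.ext
    apply LinearMap.ext
    intro τ
    have e : f.1 (τ * ρ * σ) = 0 := by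
      rw [← contract_apply, show contract σ f = 0 from h]; rfl
    rw [contract_apply, smul_eq_mul, ← mul_assoc, e]; rfl

/-- The apolar algebra `Apolar(f) = S / Ann(f)`. -/
abbrev Apolar (f : DP k n) : Type _ := PS k n ⧸ Ann f

theorem coeff_eq_zero_of_mem_mm_pow {D : ℕ} {σ : PS k n} (hσ : σ ∈ mm k n ^ D)
    (a : Fin n →₀ ℕ) (ha : a.degree < D) : MvPowerSeries.coeff a σ = 0 := by
  suffices h : ∀ D : ℕ, ∀ σ ∈ mm k n ^ D, (D : ℕ∞) ≤ σ.order by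
    exact MvPowerSeries.coeff_of_lt_order (lt_of_lt_of_le (by exact_mod_cast ha) (h D σ hσ))
  intro D
  induction D with
  | zero => intro σ _; simp
  | succ D ih =>
    intro σ hσ
    rw [pow_succ] at hσ
    refine Submodule.mul_induction_on hσ (fun x hx y hy => ?_) (fun x y hx hy => ?_)
    · refine le_trans ?_ MvPowerSeries.le_order_mul
      have h1 : (1 : ℕ∞) ≤ y.order := by
        rw [MvPowerSeries.one_le_order_iff_constCoeff_eq_zero]
        by_contra hne
        exact (IsLocalRing.mem_maximalIdeal _).1 hy
          (MvPowerSeries.isUnit_iff_constantCoeff.2 (isUnit_iff_ne_zero.2 hne))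
      rw [Nat.cast_succ]
      exact add_le_add (ih x hx) h1
    · exact le_trans (le_min hx hy) MvPowerSeries.min_order_le_add

/-- The divided power monomial `x^[a]`, dual to `α^a`: `⟨α^b, x^[a]⟩ = δ_{ab}`, i.e.
`⟨σ, x^[a]⟩` is the coefficient of `α^a` in `σ`. -/
def dpMonomial (a : Fin n →₀ ℕ) : DP k n :=
  ⟨MvPowerSeries.coeff a, a.degree + 1, fun _ hD _ hσ => coeff_eq_zero_of_mem_mm_pow hσ a hD⟩

/-- The coefficient `⟨α^a, f⟩` of `x^[a]` in `f`. -/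
def coeff (a : Fin n →₀ ℕ) (f : DP k n) : k := f.1 (MvPowerSeries.monomial a 1)

/-- `f` has degree `d`: the largest total degree of a divided power monomial with nonzero
coefficient in `f` exists and equals `d` (in particular `f ≠ 0`). -/
def HasDegree (f : DP k n) (d : ℕ) : Prop :=
  IsGreatest {m : ℕ | ∃ a : Fin n →₀ ℕ, a.degree = m ∧ coeff a f ≠ 0} d

/-- The linear map on `S` that deletes all terms of degree `< e`. -/
def dropLow (e : ℕ) : PS k n →ₗ[k] PS k n where
  toFun σ := fun a => if e ≤ a.degree then MvPowerSeries.coeff a σ else 0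
  map_add' σ τ := by
    refine MvPowerSeries.ext fun a => ?_
    change (if e ≤ a.degree then MvPowerSeries.coeff a (σ + τ) else 0) =
      (if e ≤ a.degree then MvPowerSeries.coeff a σ else 0) +
        (if e ≤ a.degree then MvPowerSeries.coeff a τ else 0)
    split_ifs <;> simp
  map_smul' c σ := by
    refine MvPowerSeries.ext fun a => ?_
    change (if e ≤ a.degree then MvPowerSeries.coeff a (c • σ) else 0) =
      c • (if e ≤ a.degree then MvPowerSeries.coeff a σ else 0)
    split_ifs <;> simp

theorem coeff_dropLow (e : ℕ) (σ : PS k n) (a : Fin n →₀ ℕ) :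
    MvPowerSeries.coeff a (dropLow e σ) =
      if e ≤ a.degree then MvPowerSeries.coeff a σ else 0 := rfl

/-- The part `f_{≥ e}` of `f`: the sum of the terms of `f` of degree at least `e`.  It is given by
pairing `f` with the part of degree `≥ e` of a power series; see `partGE_dpMonomial` and
`coeff_partGE`. -/
def partGE (e : ℕ) (f : DP k n) : DP k n :=
  ⟨f.1.comp (dropLow e), by
    obtain ⟨D₀, h⟩ := f.2
    refine ⟨max D₀ e, fun D hD σ hσ => ?_⟩
    have hs : dropLow e σ = σ := by
      refine MvPowerSeries.ext fun a => ?_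
      rw [coeff_dropLow]
      split_ifs with ha
      · rfl
      · exact (coeff_eq_zero_of_mem_mm_pow hσ a
          (lt_of_lt_of_le (not_le.1 ha) (le_trans (le_max_right _ _) hD))).symm
    rw [LinearMap.comp_apply, hs]
    exact h D (le_trans (le_max_left _ _) hD) σ hσ⟩

theorem partGE_dpMonomial (e : ℕ) (a : Fin n →₀ ℕ) :
    partGE e (dpMonomial a : DP k n) = if e ≤ a.degree then dpMonomial a else 0 := by
  apply Subtype.ext
  apply LinearMap.ext
  intro σ
  change MvPowerSeries.coeff a (dropLow e σ) = _
  rw [coeff_dropLow]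
  split_ifs <;> rfl

theorem coeff_partGE (e : ℕ) (a : Fin n →₀ ℕ) (f : DP k n) :
    coeff a (partGE e f) = if e ≤ a.degree then coeff a f else 0 := by
  classical
  change f.1 (dropLow e (MvPowerSeries.monomial a 1)) = _
  by_cases h : e ≤ a.degree
  · rw [if_pos h]
    congr 1
    refine MvPowerSeries.ext fun b => ?_
    rw [coeff_dropLow, MvPowerSeries.coeff_monomial]
    by_cases hb : b = a
    · subst hb; simp [h]
    · simp [hb]
  · rw [if_neg h]
    have h0 : dropLow e (MvPowerSeries.monomial a (1 : k)) = 0 := by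
      refine MvPowerSeries.ext fun b => ?_
      rw [coeff_dropLow, MvPowerSeries.coeff_monomial]
      by_cases hb : b = a
      · subst hb; simp [h]
      · simp [hb]
    rw [h0, map_zero]

end Apolarity

namespace Apolarity

/-- The Hilbert function `H_A(i) = dim_k 𝔪_A ^ i / 𝔪_A ^ (i + 1)` of a local `k`-algebra `A`. -/
def hilbertFn (k A : Type*) [Field k] [CommRing A] [IsLocalRing A] [Algebra k A] (i : ℕ) : ℕ :=
  Module.finrank k
    (↥(IsLocalRing.maximalIdeal A ^ i) ⧸
      Submodule.comap (IsLocalRing.maximalIdeal A ^ i).subtype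
        (IsLocalRing.maximalIdeal A ^ (i + 1)))

/-- `d` is the socle degree of the local ring `A`: the largest `i` with `𝔪_A ^ i ≠ 0`. -/
def IsSocleDegree (A : Type*) [CommRing A] [IsLocalRing A] (d : ℕ) : Prop :=
  IsGreatest {i : ℕ | IsLocalRing.maximalIdeal A ^ i ≠ ⊥} d

/-- `A`, a quotient of the power series ring `S` in `n` variables over `k`, is a compressed local
algebra: it is local, has a socle degree `d`, and
`H_A(i) = min (H_S(i), H_S(d - i)) = min (binom(i+n-1, i), binom(d-i+n-1, d-i))` for `0 ≤ i ≤ d`.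
(For `n = 0` the truncated subtraction gives the correct values `H_S(0) = 1` and `H_S(i) = 0` for
`i > 0`.) -/
def IsCompressed (k : Type*) (n : ℕ) (A : Type*) [Field k] [CommRing A] [Algebra k A] : Prop :=
  ∃ _ : IsLocalRing A, ∃ d : ℕ, IsSocleDegree A d ∧ ∀ i ≤ d,
    hilbertFn k A i =
      min (Nat.choose (i + n - 1) i) (Nat.choose (d - i + n - 1) (d - i))

end Apolarity

end

noncomputable section

namespace Apolarity

section

variable {k : Type*} [Field k] {n : ℕ}

/-! Put `m = ⌊d/2⌋`. Compressedness enters through two dimension counts: `Ann f ⊆ 𝔪^(m+1)`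
(`ann_le_of_isCompressed`), and every functional of degree at most `m` equals `σ ⌟ f` for some `σ ∈
𝔪^(d-m)` (`exists_mem_contract_eq_of_isCompressed`). Hence there are `D_i ∈ 𝔪^(d-m)` such that `D_i
⌟ f` is the degree-`m` part of `α_i ⌟ f` times `-1/(m+1)`. Under `φ : α_i ↦ α_i + D_i`, a monomial
`α^a` changes to first order by `∑ a_i α^(a-e_i) D_i`. For `|a| = m+1`, applying `f` to this sum
gives `-f(α^a)`, since `∑ a_i = m+1` (Euler's relation). Higher-order corrections, and all
corrections for `|a| > m+1`, lie in `𝔪^(d+1)`, which `f` kills. So `f ∘ φ` and `f_{≥m+2}` agree on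
`𝔪^(m+1)`. This ideal contains `Ann (f ∘ φ)`, so by duality `f_{≥m+2} = u ⌟ (f ∘ φ)`. Comparing
terms of degree `d` shows that `u` is a unit, so the two annihilators coincide; and `φ` induces
`Apolar (f ∘ φ) ≃ Apolar f`. -/

/-! ### Powers of `𝔪` as the order filtration, and the dimension of `S / 𝔪^D` -/

theorem X_mem_mm (i : Fin n) : (MvPowerSeries.X i : PS k n) ∈ mm k n := by
  rw [IsLocalRing.mem_maximalIdeal, mem_nonunits_iff, MvPowerSeries.isUnit_iff_constantCoeff]
  simp

theorem mem_mm_iff {σ : PS k n} : σ ∈ mm k n ↔ MvPowerSeries.constantCoeff σ = 0 := by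
  rw [IsLocalRing.mem_maximalIdeal, mem_nonunits_iff, MvPowerSeries.isUnit_iff_constantCoeff,
    isUnit_iff_ne_zero, not_not]

theorem monomial_mem_mm_pow (a : Fin n →₀ ℕ) (c : k) :
    (MvPowerSeries.monomial a c : PS k n) ∈ mm k n ^ a.degree := by
  have h : ∀ s : Finset (Fin n),
      ∏ i ∈ s, (MvPowerSeries.X i : PS k n) ^ a i ∈ mm k n ^ ∑ i ∈ s, a i := by
    classical
    intro s
    induction s using Finset.induction_on with
    | empty => simp
    | insert i s hi ih =>
      rw [Finset.prod_insert hi, Finset.sum_insert hi, pow_add]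
      exact Ideal.mul_mem_mul (Ideal.pow_mem_pow (X_mem_mm i) _) ih
  have e : (MvPowerSeries.monomial a c : PS k n) =
      MvPowerSeries.C c * ∏ i, (MvPowerSeries.X i : PS k n) ^ a i := by
    simp_rw [MvPowerSeries.X_pow_eq]
    rw [MvPowerSeries.prod_monomial, ← MvPowerSeries.monomial_zero_eq_C_apply,
      MvPowerSeries.monomial_mul_monomial, Finsupp.univ_sum_single]
    simp
  rw [e, Finsupp.degree_eq_sum]
  exact Ideal.mul_mem_left _ _ (h _)

/-- Choose for each exponent `a` of degree at least `D` a divisor `p a ≤ a` of degree exactly `D`.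
Grouping the terms of `σ` by `p a` writes it as a finite sum of `α^b τ_b`, although `σ` may have
infinitely many terms. -/
theorem mem_span_monomial_of_coeff_eq_zero {D : ℕ} {σ : PS k n}
    (h : ∀ a : Fin n →₀ ℕ, a.degree < D → MvPowerSeries.coeff a σ = 0) :
    σ ∈ Ideal.span {τ : PS k n | ∃ b : Fin n →₀ ℕ, b.degree = D ∧
      τ = MvPowerSeries.monomial b 1} := by
  classical
  have hex : ∀ a : Fin n →₀ ℕ, ∃ b : Fin n →₀ ℕ, D ≤ a.degree → b ≤ a ∧ b.degree = D := by
    intro a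
    by_cases ha : D ≤ a.degree
    · obtain ⟨b, hb, hD⟩ := Finsupp.exists_le_degree_eq a D ha
      exact ⟨b, fun _ => ⟨hb, hD⟩⟩
    · exact ⟨0, fun h => absurd h ha⟩
  choose p hp using hex
  let B : Finset (Fin n →₀ ℕ) := (Finsupp.finite_of_degree_eq (σ := Fin n) D).toFinset
  have hB : ∀ b, b ∈ B ↔ b.degree = D := fun b => by simp [B]
  let τ : (Fin n →₀ ℕ) → PS k n := fun b c =>
    if p (c + b) = b then MvPowerSeries.coeff (c + b) σ else 0
  have hτ : ∀ b c, MvPowerSeries.coeff c (τ b) =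
    if p (c + b) = b then MvPowerSeries.coeff (c + b) σ else 0 := fun _ _ => rfl
  have e : σ = ∑ b ∈ B, MvPowerSeries.monomial b 1 * τ b := by
    ext a
    rw [map_sum]
    simp_rw [MvPowerSeries.coeff_monomial_mul, hτ, one_mul]
    by_cases ha : D ≤ a.degree
    · obtain ⟨h1, h2⟩ := hp a ha
      rw [Finset.sum_eq_single (p a)]
      · rw [if_pos h1, tsub_add_cancel_of_le h1, if_pos rfl]
      · intro b _ hne
        split_ifs with h3 h4
        · rw [tsub_add_cancel_of_le h3] at h4
          exact absurd h4.symm hne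
        · rfl
        · rfl
      · intro h3
        exact absurd ((hB _).2 h2) h3
    · rw [h a (not_le.1 ha), Finset.sum_eq_zero]
      intro b hb
      rw [if_neg]
      intro hle
      exact ha ((hB b).1 hb ▸ Finsupp.degree_mono hle)
  rw [e]
  exact Ideal.sum_mem _ fun b hb =>
    Ideal.mul_mem_right _ _ (Ideal.subset_span ⟨b, (hB b).1 hb, rfl⟩)

/-- `𝔪 ^ D` consists of the power series without terms of degree less than `D`. -/
theorem mem_mm_pow_iff {D : ℕ} {σ : PS k n} :
    σ ∈ mm k n ^ D ↔ ∀ a : Fin n →₀ ℕ, a.degree < D → MvPowerSeries.coeff a σ = 0 := by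
  refine ⟨fun h a ha => coeff_eq_zero_of_mem_mm_pow h a ha, fun h => ?_⟩
  refine Ideal.span_le.2 ?_ (mem_span_monomial_of_coeff_eq_zero h)
  rintro _ ⟨b, rfl, rfl⟩
  exact monomial_mem_mm_pow b 1

theorem mm_eq_span_X : mm k n = Ideal.span (Set.range MvPowerSeries.X) := by
  refine le_antisymm (fun σ hσ => ?_) (Ideal.span_le.2 ?_)
  · rw [← pow_one (mm k n), mem_mm_pow_iff] at hσ
    refine Ideal.span_le.2 ?_ (mem_span_monomial_of_coeff_eq_zero hσ)
    rintro _ ⟨b, hb, rfl⟩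
    obtain ⟨i, rfl⟩ : b ∈ Set.range fun i : Fin n => Finsupp.single i 1 := by
      rw [Finsupp.range_single_one]
      exact hb
    exact Ideal.subset_span ⟨i, rfl⟩
  · rintro _ ⟨i, rfl⟩
    exact X_mem_mm i

theorem dropLow_eq_self {e : ℕ} {σ : PS k n} (h : σ ∈ mm k n ^ e) : dropLow e σ = σ := by
  ext a
  rw [coeff_dropLow]
  split_ifs with ha
  · rfl
  · exact (mem_mm_pow_iff.1 h a (not_le.1 ha)).symm

theorem dropLow_monomial (e : ℕ) (a : Fin n →₀ ℕ) (c : k) :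
    dropLow e (MvPowerSeries.monomial a c : PS k n) =
      if e ≤ a.degree then MvPowerSeries.monomial a c else 0 := by
  classical
  ext b
  rw [coeff_dropLow]
  by_cases hb : b = a
  · subst hb
    split_ifs <;> simp
  · split_ifs <;> simp [MvPowerSeries.coeff_monomial, hb]

/-- Two functionals vanishing on `𝔪 ^ D` agree if they agree on monomials of degree less
than `D`. -/
theorem linearMap_ext_of_monomial {V : Type*} [AddCommGroup V] [Module k V] {D : ℕ}
    {g h : PS k n →ₗ[k] V} (hg : ∀ σ ∈ mm k n ^ D, g σ = 0) (hh : ∀ σ ∈ mm k n ^ D, h σ = 0)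
    {j : ℕ} (hgh : ∀ a : Fin n →₀ ℕ, j ≤ a.degree → a.degree < D →
      g (MvPowerSeries.monomial a 1) = h (MvPowerSeries.monomial a 1)) (σ : PS k n)
    (hσ : σ ∈ mm k n ^ j) : g σ = h σ := by
  classical
  let B : Finset (Fin n →₀ ℕ) := (Finsupp.finite_of_degree_lt (σ := Fin n) D).toFinset
  have hB : ∀ b, b ∈ B ↔ b.degree < D := fun b => by simp [B]
  let p : PS k n := ∑ b ∈ B, MvPowerSeries.coeff b σ • MvPowerSeries.monomial b 1
  have hp : σ - p ∈ mm k n ^ D := by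
    refine mem_mm_pow_iff.2 fun a ha => ?_
    rw [map_sub, map_sum, Finset.sum_eq_single a]
    · simp
    · intro b _ hne
      simp [MvPowerSeries.coeff_monomial, hne.symm]
    · intro h
      exact absurd ((hB a).2 ha) h
  have e : g p = h p := by
    simp only [p, map_sum, map_smul]
    refine Finset.sum_congr rfl fun b hb => ?_
    by_cases hj : j ≤ b.degree
    · rw [hgh b hj ((hB b).1 hb)]
    · rw [mem_mm_pow_iff.1 hσ b (not_le.1 hj), zero_smul, zero_smul]
  rw [← sub_add_cancel σ p, map_add, map_add, hg _ hp, hh _ hp, e]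

theorem card_degree_lt (n D : ℕ) :
    Nat.card {a : Fin n →₀ ℕ // a.degree < D} =
      ∑ i ∈ Finset.range D, Nat.choose (i + n - 1) i := by
  classical
  have e : ∀ a : Fin n →₀ ℕ, a ∈ (Finset.range D).biUnion
      (fun i => (Finset.univ : Finset (Fin n)).finsuppAntidiag i) ↔ a.degree < D := by
    intro a
    simp [Finsupp.degree_eq_sum]
  rw [← Nat.card_congr (Equiv.subtypeEquivRight e), Nat.card_eq_fintype_card, Fintype.card_coe,
    Finset.card_biUnion]
  · refine Finset.sum_congr rfl fun i _ => ?_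
    rw [Finset.card_finsuppAntidiag_nat_eq_choose, Finset.card_fin, add_comm n i]
  · intro i _ j _ hij
    refine Finset.disjoint_left.2 fun a hi hj => hij ?_
    rw [Finset.mem_finsuppAntidiag] at hi hj
    exact hi.1.symm.trans hj.1

/-- The coefficients of degree less than `D`. -/
def lowCoeffs (k : Type*) [Field k] (n D : ℕ) :
    PS k n →ₗ[k] ({a : Fin n →₀ ℕ // a.degree < D} → k) :=
  LinearMap.pi fun a => MvPowerSeries.coeff a.1

theorem ker_lowCoeffs (D : ℕ) :
    LinearMap.ker (lowCoeffs k n D) = (mm k n ^ D).restrictScalars k := by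
  ext σ
  rw [LinearMap.mem_ker, Submodule.restrictScalars_mem, mem_mm_pow_iff]
  exact ⟨fun h a ha => congrFun h ⟨a, ha⟩, fun h => funext fun a => h a.1 a.2⟩

instance finite_degree_lt (D : ℕ) : Finite {a : Fin n →₀ ℕ // a.degree < D} :=
  (Finsupp.finite_of_degree_lt (σ := Fin n) D).to_subtype

theorem finiteDimensional_quotient_mm_pow (D : ℕ) :
    FiniteDimensional k (PS k n ⧸ (mm k n ^ D).restrictScalars k) := by
  rw [← ker_lowCoeffs]
  exact (lowCoeffs k n D).quotKerEquivRange.symm.finiteDimensional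

theorem finrank_quotient_mm_pow_le (D : ℕ) :
    Module.finrank k (PS k n ⧸ (mm k n ^ D).restrictScalars k) ≤
      ∑ i ∈ Finset.range D, Nat.choose (i + n - 1) i := by
  rw [← ker_lowCoeffs, (lowCoeffs k n D).quotKerEquivRange.finrank_eq, ← card_degree_lt]
  refine (Submodule.finrank_le _).trans ?_
  cases nonempty_fintype {a : Fin n →₀ ℕ // a.degree < D}
  rw [Module.finrank_fintype_fun_eq_card, Nat.card_eq_fintype_card]

end

/-! ### Dimensions of powers of the maximal ideal from the Hilbert function -/

section LocalAlgebra

variable {k A : Type*} [Field k] [CommRing A] [IsLocalRing A] [Algebra k A]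

theorem finrank_maximalIdeal_pow [FiniteDimensional k A] (i : ℕ) :
    Module.finrank k ↥(IsLocalRing.maximalIdeal A ^ i) =
      hilbertFn k A i + Module.finrank k ↥(IsLocalRing.maximalIdeal A ^ (i + 1)) := by
  have hle : IsLocalRing.maximalIdeal A ^ (i + 1) ≤ IsLocalRing.maximalIdeal A ^ i :=
    Ideal.pow_le_pow_right (Nat.le_succ i)
  let N := Submodule.comap (IsLocalRing.maximalIdeal A ^ i).subtype
    (IsLocalRing.maximalIdeal A ^ (i + 1))
  have : FiniteDimensional k ↥(IsLocalRing.maximalIdeal A ^ i) :=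
    inferInstanceAs (FiniteDimensional k
      ↥((IsLocalRing.maximalIdeal A ^ i).restrictScalars k))
  have h1 := Submodule.finrank_quotient_add_finrank (N.restrictScalars k)
  have h2 : Module.finrank k ↥(N.restrictScalars k) =
      Module.finrank k ↥(IsLocalRing.maximalIdeal A ^ (i + 1)) :=
    ((Submodule.comapSubtypeEquivOfLe hle).restrictScalars k).finrank_eq
  rw [← h1, h2, (Submodule.Quotient.restrictScalarsEquiv k N).finrank_eq]
  rfl

theorem finrank_eq_sum_hilbertFn_add [FiniteDimensional k A] (i j : ℕ) :
    Module.finrank k ↥(IsLocalRing.maximalIdeal A ^ i) =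
      ∑ l ∈ Finset.range j, hilbertFn k A (i + l) +
        Module.finrank k ↥(IsLocalRing.maximalIdeal A ^ (i + j)) := by
  induction j with
  | zero => simp
  | succ j ih =>
    rw [ih, Finset.sum_range_succ, finrank_maximalIdeal_pow (i + j), add_assoc, add_assoc]

end LocalAlgebra

variable {k : Type*} [Field k] {n : ℕ}

/-! ### The perfect pairing on `Apolar f` -/

theorem mem_Ann_iff {f : DP k n} {σ : PS k n} : σ ∈ Ann f ↔ ∀ τ, f.1 (τ * σ) = 0 := by
  refine ⟨fun h τ => ?_, fun h => Subtype.ext (LinearMap.ext h)⟩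
  rw [← contract_apply, show contract σ f = 0 from h]
  rfl

theorem apply_eq_zero_of_mem_Ann {f : DP k n} {σ : PS k n} (h : σ ∈ Ann f) : f.1 σ = 0 := by
  simpa using mem_Ann_iff.1 h 1

theorem mm_pow_le_Ann {f : DP k n} {D : ℕ} (h : ∀ σ ∈ mm k n ^ D, f.1 σ = 0) :
    mm k n ^ D ≤ Ann f :=
  fun _ hσ => mem_Ann_iff.2 fun τ => h _ (Ideal.mul_mem_left _ τ hσ)

theorem HasDegree.apply_eq_zero {f : DP k n} {d : ℕ} (hf : HasDegree f d) {σ : PS k n}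
    (hσ : σ ∈ mm k n ^ (d + 1)) : f.1 σ = 0 := by
  obtain ⟨D, hD⟩ := f.2
  refine linearMap_ext_of_monomial (h := (0 : PS k n →ₗ[k] k)) (hD D le_rfl)
    (fun _ _ => rfl) (fun a ha _ => ?_) σ hσ
  by_contra hne
  exact absurd (hf.2 ⟨a, rfl, hne⟩) (by omega)

theorem finiteDimensional_apolar (f : DP k n) : FiniteDimensional k (Apolar f) := by
  obtain ⟨D, hD⟩ := f.2
  have := finiteDimensional_quotient_mm_pow (k := k) (n := n) D
  have hle : (mm k n ^ D).restrictScalars k ≤ (Ann f).restrictScalars k :=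
    mm_pow_le_Ann (hD D le_rfl)
  have hs : Function.Surjective
      (((mm k n ^ D).restrictScalars k).liftQ (Ideal.Quotient.mkₐ k (Ann f)).toLinearMap
        (fun σ hσ => Ideal.Quotient.eq_zero_iff_mem.2 (hle hσ))) := by
    intro x
    obtain ⟨σ, rfl⟩ := Ideal.Quotient.mk_surjective x
    exact ⟨Submodule.Quotient.mk σ, rfl⟩
  exact Module.Finite.of_surjective _ hs

/-- The functional induced by `f` on `Apolar f`. -/
def apolarFunctional (f : DP k n) : Apolar f →ₗ[k] k :=
  ((Ann f).restrictScalars k).liftQ f.1 (fun _ hσ => apply_eq_zero_of_mem_Ann hσ) ∘ₗ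
    (Submodule.Quotient.restrictScalarsEquiv k (Ann f)).symm.toLinearMap

/-- The map `A → Hom_k(A, k)`, `x ↦ (y ↦ f(x y))` for `A = Apolar f`. -/
def apolarToDual (f : DP k n) : Apolar f →ₗ[k] Module.Dual k (Apolar f) :=
  (LinearMap.mul k (Apolar f)).compr₂ (apolarFunctional f)

theorem apolarToDual_mk (f : DP k n) (σ τ : PS k n) :
    apolarToDual f (Ideal.Quotient.mk (Ann f) σ) (Ideal.Quotient.mk (Ann f) τ) = f.1 (σ * τ) := rfl

theorem apolarToDual_injective (f : DP k n) : Function.Injective (apolarToDual f) := by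
  rw [← LinearMap.ker_eq_bot, LinearMap.ker_eq_bot']
  intro x hx
  obtain ⟨σ, rfl⟩ := Ideal.Quotient.mk_surjective x
  refine Ideal.Quotient.eq_zero_iff_mem.2 (mem_Ann_iff.2 fun τ => ?_)
  rw [mul_comm, ← apolarToDual_mk, hx, LinearMap.zero_apply]

/-- The pairing on `Apolar f` as an isomorphism onto the dual space. -/
def apolarEquivDual (f : DP k n) : Apolar f ≃ₗ[k] Module.Dual k (Apolar f) :=
  have := finiteDimensional_apolar f
  LinearEquiv.ofInjectiveOfFinrankEq (apolarToDual f) (apolarToDual_injective f)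
    Subspace.dual_finrank_eq.symm

theorem apolarEquivDual_apply (f : DP k n) (x : Apolar f) :
    apolarEquivDual f x = apolarToDual f x := rfl

/-- A functional vanishing on `Ann f` is a contraction of `f`. -/
theorem exists_contract_eq (f : DP k n) (g : PS k n →ₗ[k] k) (hg : ∀ σ ∈ Ann f, g σ = 0) :
    ∃ σ, ∀ τ, f.1 (τ * σ) = g τ := by
  let gbar : Apolar f →ₗ[k] k :=
    ((Ann f).restrictScalars k).liftQ g (fun σ hσ => hg σ hσ) ∘ₗ
      (Submodule.Quotient.restrictScalarsEquiv k (Ann f)).symm.toLinearMap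
  obtain ⟨x, hx⟩ := (apolarEquivDual f).surjective gbar
  obtain ⟨σ, rfl⟩ := Ideal.Quotient.mk_surjective x
  refine ⟨σ, fun τ => ?_⟩
  rw [mul_comm, ← apolarToDual_mk, ← apolarEquivDual_apply, hx]
  rfl

theorem finrank_orthogonal_add (f : DP k n) (U : Submodule k (Apolar f)) :
    Module.finrank k (U.dualAnnihilator.comap (apolarEquivDual f).toLinearMap) +
      Module.finrank k U = Module.finrank k (Apolar f) := by
  have := finiteDimensional_apolar f
  rw [← Subspace.finrank_add_finrank_dualAnnihilator_eq U, add_comm]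
  congr 1
  rw [Submodule.comap_equiv_eq_map_symm]
  exact LinearEquiv.finrank_map_eq _ _

theorem maximalIdeal_apolar_pow (f : DP k n) [IsLocalRing (Apolar f)] (i : ℕ) :
    IsLocalRing.maximalIdeal (Apolar f) ^ i =
      (mm k n ^ i).map (Ideal.Quotient.mk (Ann f)) := by
  rw [Ideal.map_pow]
  congr 1
  exact (IsLocalRing.map_maximalIdeal_of_surjective _ Ideal.Quotient.mk_surjective).symm

theorem mk_mem_maximalIdeal_pow {f : DP k n} [IsLocalRing (Apolar f)] {i : ℕ} {σ : PS k n} :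
    Ideal.Quotient.mk (Ann f) σ ∈ IsLocalRing.maximalIdeal (Apolar f) ^ i ↔
      ∃ τ ∈ mm k n ^ i, τ - σ ∈ Ann f := by
  rw [maximalIdeal_apolar_pow, Ideal.mem_map_iff_of_surjective _ Ideal.Quotient.mk_surjective]
  simp only [Ideal.Quotient.mk_eq_mk_iff_sub_mem]

theorem HasDegree.maximalIdeal_pow_eq_bot {f : DP k n} {d : ℕ} (hf : HasDegree f d)
    [IsLocalRing (Apolar f)] : IsLocalRing.maximalIdeal (Apolar f) ^ (d + 1) = ⊥ := by
  rw [maximalIdeal_apolar_pow, Ideal.map_eq_bot_iff_le_ker, Ideal.mk_ker]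
  exact mm_pow_le_Ann fun σ hσ => hf.apply_eq_zero hσ

theorem HasDegree.eq_socleDegree {f : DP k n} {d e : ℕ} (hf : HasDegree f d)
    [IsLocalRing (Apolar f)] (he : IsSocleDegree (Apolar f) e) : e = d := by
  refine le_antisymm (not_lt.1 fun h => he.1 ?_) (he.2 fun h => ?_)
  · rw [eq_bot_iff, ← hf.maximalIdeal_pow_eq_bot]
    exact Ideal.pow_le_pow_right h
  · rw [maximalIdeal_apolar_pow, Ideal.map_eq_bot_iff_le_ker, Ideal.mk_ker] at h
    obtain ⟨a, rfl, ha⟩ := hf.1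
    exact ha (apply_eq_zero_of_mem_Ann (h (monomial_mem_mm_pow a 1)))

/-! ### Consequences of compressedness -/

/-- For `n = 0` the values are `1, 0, 0, …`, so monotonicity fails there. -/
theorem choose_add_sub_one_mono (hn : n ≠ 0) {i j : ℕ} (h : i ≤ j) :
    Nat.choose (i + n - 1) i ≤ Nat.choose (j + n - 1) j := by
  obtain ⟨n, rfl⟩ := Nat.exists_eq_succ_of_ne_zero hn
  simp only [Nat.add_succ_sub_one, Nat.succ_eq_add_one]
  rw [Nat.choose_symm_add, Nat.choose_symm_add]
  exact Nat.choose_le_choose _ (by omega)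

theorem HasDegree.ne_zero {f : DP k n} {d : ℕ} (hf : HasDegree f d) (hd : d ≠ 0) : n ≠ 0 := by
  rintro rfl
  obtain ⟨a, rfl, -⟩ := hf.1
  exact hd (by rw [Subsingleton.elim a 0, map_zero])

/-- Since `2m ≤ d`, the minimum is its first entry for `i ≤ m` and its second for `i ≥ d - m`; the
two ranges mirror each other under `i ↦ d - i`. -/
theorem finrank_sum_of_isCompressed {f : DP k n} {d m : ℕ} (hf : HasDegree f d) (hd : d ≠ 0)
    (hm : 2 * m ≤ d) [IsLocalRing (Apolar f)]
    (hA : ∀ i ≤ d, hilbertFn k (Apolar f) i =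
      min (Nat.choose (i + n - 1) i) (Nat.choose (d - i + n - 1) (d - i))) :
    Module.finrank k (Apolar f) = ∑ i ∈ Finset.range (m + 1), Nat.choose (i + n - 1) i +
        Module.finrank k ↥(IsLocalRing.maximalIdeal (Apolar f) ^ (m + 1)) ∧
      Module.finrank k ↥(IsLocalRing.maximalIdeal (Apolar f) ^ (d - m)) =
        ∑ i ∈ Finset.range (m + 1), Nat.choose (i + n - 1) i := by
  have := finiteDimensional_apolar f
  have hn := hf.ne_zero hd
  constructor
  · have h0 : Module.finrank k ↥(IsLocalRing.maximalIdeal (Apolar f) ^ 0) =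
        Module.finrank k (Apolar f) := by
      rw [pow_zero, Ideal.one_eq_top]
      exact finrank_top k (Apolar f)
    rw [← h0, finrank_eq_sum_hilbertFn_add 0 (m + 1), zero_add]
    congr 1
    refine Finset.sum_congr rfl fun i hi => ?_
    rw [Finset.mem_range] at hi
    rw [zero_add, hA i (by omega), min_eq_left (choose_add_sub_one_mono hn (by omega))]
  · have h1 : d - m + (m + 1) = d + 1 := by omega
    rw [finrank_eq_sum_hilbertFn_add (d - m) (m + 1), h1, hf.maximalIdeal_pow_eq_bot,
      show Module.finrank k ↥(⊥ : Ideal (Apolar f)) = 0 from finrank_bot k (Apolar f), add_zero,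
      ← Finset.sum_range_reflect]
    refine Finset.sum_congr rfl fun i hi => ?_
    rw [Finset.mem_range] at hi
    have h2 : d - (d - m + (m + 1 - 1 - i)) = i := by omega
    rw [hA _ (by omega), h2, min_eq_right (choose_add_sub_one_mono hn (by omega))]

/-- The surjection `S / 𝔪^(m+1) → A / 𝔪_A^(m+1)` is injective, because the target already has the
largest dimension the source can have. -/
theorem ann_le_of_isCompressed {f : DP k n} {d m : ℕ} (hf : HasDegree f d) (hd : d ≠ 0)
    (hm : 2 * m ≤ d) (hA : IsCompressed k n (Apolar f)) : Ann f ≤ mm k n ^ (m + 1) := by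
  obtain ⟨hloc, e, he, hA⟩ := hA
  obtain rfl := hf.eq_socleDegree he
  obtain ⟨h1, -⟩ := finrank_sum_of_isCompressed hf hd hm hA
  have := finiteDimensional_apolar f
  have := finiteDimensional_quotient_mm_pow (k := k) (n := n) (m + 1)
  let U := (IsLocalRing.maximalIdeal (Apolar f) ^ (m + 1)).restrictScalars k
  have h2 : Module.finrank k (Apolar f ⧸ U) + Module.finrank k U = Module.finrank k (Apolar f) :=
    Submodule.finrank_quotient_add_finrank U
  have h3 : Module.finrank k U =
    Module.finrank k ↥(IsLocalRing.maximalIdeal (Apolar f) ^ (m + 1)) := rfl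
  let q : PS k n →ₗ[k] Apolar f ⧸ U := U.mkQ ∘ₗ (Ideal.Quotient.mkₐ k (Ann f)).toLinearMap
  have hq : ∀ σ, Ideal.Quotient.mk (Ann f) σ ∈ IsLocalRing.maximalIdeal (Apolar f) ^ (m + 1) →
    q σ = 0 := fun σ hσ => (Submodule.Quotient.mk_eq_zero U).2 hσ
  let φ := ((mm k n ^ (m + 1)).restrictScalars k).liftQ q
    (fun σ hσ => hq σ (mk_mem_maximalIdeal_pow.2 ⟨σ, hσ, by simp⟩))
  have hφ : Function.Surjective φ := by
    intro x
    obtain ⟨y, rfl⟩ := Submodule.Quotient.mk_surjective _ x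
    obtain ⟨σ, rfl⟩ := Ideal.Quotient.mk_surjective y
    exact ⟨Submodule.Quotient.mk σ, rfl⟩
  have h4 := finrank_quotient_mm_pow_le (k := k) (n := n) (m + 1)
  have h5 := LinearMap.finrank_le_finrank_of_surjective hφ
  have hinj : Function.Injective φ :=
    (LinearMap.injective_iff_surjective_of_finrank_eq_finrank (by omega)).2 hφ
  intro σ hσ
  have h6 : φ (Submodule.Quotient.mk σ) = φ 0 := by
    rw [map_zero]
    refine hq σ ?_
    rw [Ideal.Quotient.eq_zero_iff_mem.2 hσ]
    exact zero_mem _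
  exact (Submodule.Quotient.mk_eq_zero _).1 (hinj h6)

/-- If `Apolar f` is compressed, every functional of degree at most `m ≤ d / 2` is the
contraction of `f` by an element of `𝔪 ^ (d - m)`. -/
theorem exists_mem_contract_eq_of_isCompressed {f : DP k n} {d m : ℕ} (hf : HasDegree f d)
    (hd : d ≠ 0) (hm : 2 * m ≤ d) (hA : IsCompressed k n (Apolar f)) (g : PS k n →ₗ[k] k)
    (hg : ∀ σ ∈ mm k n ^ (m + 1), g σ = 0) :
    ∃ σ ∈ mm k n ^ (d - m), ∀ τ, f.1 (τ * σ) = g τ := by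
  obtain ⟨σ, hσ⟩ := exists_contract_eq f g
    fun σ hσ => hg σ (ann_le_of_isCompressed hf hd hm hA hσ)
  obtain ⟨hloc, e, he, hA⟩ := hA
  obtain rfl := hf.eq_socleDegree he
  obtain ⟨h1, h2⟩ := finrank_sum_of_isCompressed hf hd hm hA
  have := finiteDimensional_apolar f
  let U := (IsLocalRing.maximalIdeal (Apolar f) ^ (m + 1)).restrictScalars k
  let V := (IsLocalRing.maximalIdeal (Apolar f) ^ (e - m)).restrictScalars k
  have hVU : V ≤ U.dualAnnihilator.comap (apolarEquivDual f).toLinearMap := by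
    intro x hx
    rw [Submodule.mem_comap, Submodule.mem_dualAnnihilator]
    intro y hy
    have hxy : x * y ∈ IsLocalRing.maximalIdeal (Apolar f) ^ (e + 1) := by
      rw [show e + 1 = e - m + (m + 1) by omega, pow_add]
      exact Ideal.mul_mem_mul hx hy
    rw [hf.maximalIdeal_pow_eq_bot, Ideal.mem_bot] at hxy
    change apolarFunctional f (x * y) = 0
    rw [hxy, map_zero]
  have h3 := finrank_orthogonal_add f U
  have h4 : Module.finrank k U =
    Module.finrank k ↥(IsLocalRing.maximalIdeal (Apolar f) ^ (m + 1)) := rfl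
  have h5 : Module.finrank k V =
    Module.finrank k ↥(IsLocalRing.maximalIdeal (Apolar f) ^ (e - m)) := rfl
  -- Both `𝔪_A^(d-m)` and the orthogonal of `𝔪_A^(m+1)` have dimension `∑_{i ≤ m} binom(i+n-1, i)`.
  -- The class of `σ` is in the latter because `g` kills `𝔪^(m+1)`.
  have hV := Submodule.eq_of_le_of_finrank_le hVU (by omega)
  have hσV : Ideal.Quotient.mk (Ann f) σ ∈ V := by
    rw [hV, Submodule.mem_comap, Submodule.mem_dualAnnihilator]
    intro y hy
    obtain ⟨τ, rfl⟩ := Ideal.Quotient.mk_surjective y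
    obtain ⟨ρ, hρ, hρτ⟩ := mk_mem_maximalIdeal_pow.1 hy
    rw [← (Ideal.Quotient.mk_eq_mk_iff_sub_mem ρ τ).2 hρτ]
    change f.1 (σ * ρ) = 0
    rw [mul_comm, hσ, hg ρ hρ]
  obtain ⟨ρ, hρ, hρσ⟩ := mk_mem_maximalIdeal_pow.1 hσV
  refine ⟨ρ, hρ, fun τ => ?_⟩
  rw [← hσ τ, ← sub_eq_zero, ← map_sub, ← mul_sub]
  exact mem_Ann_iff.1 hρσ τ

/-! ### Endomorphisms of `S` close to the identity -/

section Endomorphism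

variable (φ : PS k n →ₐ[k] PS k n)

/-- The constant term of `φ` is a surjection onto `k`, so its kernel is the unique maximal ideal. -/
theorem algHom_map_mem_mm {σ : PS k n} (hσ : σ ∈ mm k n) : φ σ ∈ mm k n := by
  let ψ : PS k n →+* k := (MvPowerSeries.constantCoeff).comp φ.toRingHom
  have hψ : Function.Surjective ψ := fun c =>
    ⟨algebraMap k (PS k n) c, by
      change MvPowerSeries.constantCoeff (φ (algebraMap k (PS k n) c)) = c
      rw [AlgHom.commutes]
      simp [MvPowerSeries.algebraMap_apply]⟩
  have hker : RingHom.ker ψ = mm k n :=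
    IsLocalRing.eq_maximalIdeal (RingHom.ker_isMaximal_of_surjective ψ hψ)
  rw [← hker] at hσ
  exact mem_mm_iff.2 hσ

theorem algHom_map_mem_mm_pow {D : ℕ} {σ : PS k n} (hσ : σ ∈ mm k n ^ D) :
    φ σ ∈ mm k n ^ D := by
  have h : (mm k n ^ D).map φ ≤ mm k n ^ D := by
    rw [Ideal.map_pow]
    refine Ideal.pow_right_mono (Ideal.map_le_iff_le_comap.2 fun σ hσ => ?_) D
    exact algHom_map_mem_mm φ hσ
  exact h (Ideal.mem_map_of_mem φ hσ)

theorem sub_constantCoeff_mem_mm (σ : PS k n) :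
    σ - algebraMap k _ (MvPowerSeries.constantCoeff σ) ∈ mm k n := by
  rw [mem_mm_iff]
  simp [MvPowerSeries.algebraMap_apply]

variable {φ} {t : ℕ}

/-- No continuity of `φ` is needed: `𝔪` is generated by the variables, and the twisted Leibniz rule
for `φ - id` improves an estimate on all coefficients by one order on `𝔪`. Iterating reaches `t`; a
second induction handles powers of `𝔪`. -/
theorem algHom_sub_mem_of_X (h : ∀ i, φ (MvPowerSeries.X i) - MvPowerSeries.X i ∈ mm k n ^ (t + 1))
    {j : ℕ} {σ : PS k n} (hσ : σ ∈ mm k n ^ j) : φ σ - σ ∈ mm k n ^ (j + t) := by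
  have hall : ∀ s ≤ t, (∀ σ ∈ mm k n, φ σ - σ ∈ mm k n ^ (s + 1)) →
      ∀ σ : PS k n, φ σ - σ ∈ mm k n ^ (s + 1) := by
    intro s _ hs σ
    have := hs _ (sub_constantCoeff_mem_mm σ)
    rw [map_sub, AlgHom.commutes, sub_sub_sub_cancel_right] at this
    exact this
  have hone : ∀ s ≤ t, ∀ σ ∈ mm k n, φ σ - σ ∈ mm k n ^ (s + 1) := by
    intro s
    induction s with
    | zero =>
      intro _ σ hσ
      rw [zero_add, pow_one]
      exact sub_mem (algHom_map_mem_mm φ hσ) hσ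
    | succ s ih =>
      intro hs σ hσ
      have ih' := hall s (by omega) (ih (by omega))
      rw [mm_eq_span_X] at hσ
      refine Submodule.span_induction (p := fun σ _ => φ σ - σ ∈ mm k n ^ (s + 1 + 1)) ?_ ?_ ?_ ?_ hσ
      · rintro _ ⟨i, rfl⟩
        exact Ideal.pow_le_pow_right (by omega) (h i)
      · simp
      · intro x y _ _ hx hy
        rw [map_add, add_sub_add_comm]
        exact add_mem hx hy
      · intro a x hx hx'
        have e : φ (a • x) - a • x = φ a * (φ x - x) + (φ a - a) * x := by
          rw [smul_eq_mul, map_mul]; ring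
        rw [e]
        replace hx : x ∈ mm k n := by
          rw [mm_eq_span_X]
          exact hx
        refine add_mem (Ideal.mul_mem_left _ _ hx') ?_
        rw [pow_succ]
        exact Ideal.mul_mem_mul (ih' a) hx
  induction j generalizing σ with
  | zero =>
    rw [zero_add]
    exact Ideal.pow_le_pow_right (Nat.le_succ t) (hall t le_rfl (hone t le_rfl) σ)
  | succ j ih =>
    rw [pow_succ] at hσ
    refine Submodule.mul_induction_on hσ (fun x hx y hy => ?_) (fun x y hx hy => ?_)
    · have e : φ (x * y) - x * y = (φ x - x) * φ y + x * (φ y - y) := by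
        rw [map_mul]; ring
      rw [e]
      refine add_mem ?_ ?_
      · rw [show j + 1 + t = j + t + 1 by omega, pow_succ]
        exact Ideal.mul_mem_mul (ih hx) (algHom_map_mem_mm φ hy)
      · rw [show j + 1 + t = j + (t + 1) by omega, pow_add]
        exact Ideal.mul_mem_mul hx (hone t le_rfl y hy)
    · rw [map_add, add_sub_add_comm]
      exact add_mem hx hy

/-- First order expansion of an endomorphism `α_i ↦ α_i + D_i` on a monomial. -/
theorem algHom_monomial_sub_mem {D : Fin n → PS k n} (hD : ∀ i, D i ∈ mm k n ^ (t + 1))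
    (hφ : ∀ i, φ (MvPowerSeries.X i) = MvPowerSeries.X i + D i) (a : Fin n →₀ ℕ) :
    φ (MvPowerSeries.monomial a 1) - MvPowerSeries.monomial a 1 -
      ∑ i, MvPowerSeries.monomial (a - Finsupp.single i 1) (a i : k) * D i ∈
        mm k n ^ (a.degree + 2 * t) := by
  classical
  have h : ∀ i, φ (MvPowerSeries.X i) - MvPowerSeries.X i ∈ mm k n ^ (t + 1) := fun i => by
    rw [hφ, add_sub_cancel_left]
    exact hD i
  obtain ⟨N, hN⟩ : ∃ N, a.degree = N := ⟨_, rfl⟩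
  induction N generalizing a with
  | zero =>
    rw [Finsupp.degree_eq_zero_iff] at hN
    subst hN
    simp [MvPowerSeries.monomial_zero_one]
  | succ N ih =>
    have hne : a ≠ 0 := by
      rintro rfl
      simp at hN
    obtain ⟨i, hi⟩ := Finsupp.ne_iff.1 hne
    obtain ⟨b, rfl⟩ : ∃ b : Fin n →₀ ℕ, a = b + Finsupp.single i 1 :=
      ⟨a - Finsupp.single i 1, (tsub_add_cancel_of_le (by
        rw [Finsupp.single_le_iff]
        exact Nat.one_le_iff_ne_zero.2 hi)).symm⟩
    have hdeg : (b + Finsupp.single i 1).degree = b.degree + 1 := by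
      rw [map_add, Finsupp.degree_single]
    have ihb := ih b (by omega)
    have e1 : (MvPowerSeries.monomial (b + Finsupp.single i 1) 1 : PS k n) =
        MvPowerSeries.monomial b 1 * MvPowerSeries.X i := by
      rw [MvPowerSeries.X_def, MvPowerSeries.monomial_mul_monomial, mul_one]
    have e2 : ∑ j, MvPowerSeries.monomial (b + Finsupp.single i 1 - Finsupp.single j 1)
          ((b + Finsupp.single i 1 : Fin n →₀ ℕ) j : k) * D j =
        (∑ j, MvPowerSeries.monomial (b - Finsupp.single j 1) (b j : k) * D j) *
          MvPowerSeries.X i + MvPowerSeries.monomial b 1 * D i := by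
      have e3 : MvPowerSeries.monomial b 1 * D i =
          ∑ j, if j = i then MvPowerSeries.monomial b 1 * D j else 0 := by
        rw [Finset.sum_ite_eq' Finset.univ i, if_pos (Finset.mem_univ i)]
      rw [e3, Finset.sum_mul, ← Finset.sum_add_distrib]
      refine Finset.sum_congr rfl fun j _ => ?_
      have e4 : MvPowerSeries.monomial (b - Finsupp.single j 1) (b j : k) * D j *
          MvPowerSeries.X i =
          MvPowerSeries.monomial (b + Finsupp.single i 1 - Finsupp.single j 1) (b j : k) * D j := by
        rw [mul_right_comm, MvPowerSeries.X_def, MvPowerSeries.monomial_mul_monomial, mul_one]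
        -- Truncated subtraction is harmless: where it truncates, the coefficient `b j` is zero.
        by_cases hb : b j = 0
        · simp [hb]
        · rw [tsub_add_eq_add_tsub]
          rw [Finsupp.single_le_iff]
          exact Nat.one_le_iff_ne_zero.2 hb
      rw [e4]
      by_cases hij : j = i
      · subst hij
        rw [if_pos rfl, add_tsub_cancel_right, ← add_mul, ← map_add]
        simp
      · rw [if_neg hij, add_zero]
        simp [Ne.symm hij]
    rw [e1, e2, hdeg, map_mul, hφ i]
    set x := (MvPowerSeries.monomial b 1 : PS k n)
    set dx := ∑ j, MvPowerSeries.monomial (b - Finsupp.single j 1) (b j : k) * D j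
    -- The new error is the old one times `α_i` plus the second-order term `(φ x - x) D_i`.
    have e5 : φ x * (MvPowerSeries.X i + D i) - x * MvPowerSeries.X i -
        (dx * MvPowerSeries.X i + x * D i) =
        (φ x - x - dx) * MvPowerSeries.X i + (φ x - x) * D i := by ring
    rw [e5]
    refine add_mem ?_ ?_
    · rw [show b.degree + 1 + 2 * t = b.degree + 2 * t + 1 by omega, pow_succ]
      exact Ideal.mul_mem_mul ihb (X_mem_mm i)
    · rw [show b.degree + 1 + 2 * t = b.degree + t + (t + 1) by omega, pow_add]
      exact Ideal.mul_mem_mul (algHom_sub_mem_of_X h (monomial_mem_mm_pow b 1)) (hD i)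

theorem exists_algHom_X_add {D : Fin n → PS k n} (hD : ∀ i, D i ∈ mm k n) :
    ∃ φ : PS k n →ₐ[k] PS k n, ∀ i, φ (MvPowerSeries.X i) = MvPowerSeries.X i + D i := by
  have hs : MvPowerSeries.HasSubst fun i => (MvPowerSeries.X i + D i : PS k n) :=
    MvPowerSeries.hasSubst_of_constantCoeff_zero fun i => by
      simp [mem_mm_iff.1 (hD i)]
  exact ⟨MvPowerSeries.substAlgHom hs, fun i => MvPowerSeries.substAlgHom_X hs i⟩

/-- The functional `f ∘ φ` for an endomorphism `φ` of `S`. -/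
def pullback (φ : PS k n →ₐ[k] PS k n) (f : DP k n) : DP k n :=
  ⟨f.1.comp φ.toLinearMap, by
    obtain ⟨D₀, h⟩ := f.2
    exact ⟨D₀, fun D hD σ hσ => h D hD _ (algHom_map_mem_mm_pow φ hσ)⟩⟩

theorem pullback_apply (φ : PS k n →ₐ[k] PS k n) (f : DP k n) (σ : PS k n) :
    (pullback φ f).1 σ = f.1 (φ σ) := rfl

/-- Successive approximation: replacing `σ` by the error `φ σ - σ` raises its order, and stops once
the order reaches `N`, as `𝔪^N ⊆ Ann f`. -/
theorem mk_comp_algHom_surjective {f : DP k n}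
    (h : ∀ j, ∀ σ ∈ mm k n ^ j, φ σ - σ ∈ mm k n ^ (j + 1)) :
    Function.Surjective ((Ideal.Quotient.mkₐ k (Ann f)).comp φ) := by
  obtain ⟨N, hN⟩ := f.2
  have key : ∀ j, ∀ σ ∈ mm k n ^ (N - j), ∃ τ, φ τ - σ ∈ Ann f := by
    intro j
    induction j with
    | zero =>
      intro σ hσ
      exact ⟨0, by simpa using mm_pow_le_Ann (hN N le_rfl) hσ⟩
    | succ j ih =>
      intro σ hσ
      obtain ⟨τ, hτ⟩ := ih (φ σ - σ) (Ideal.pow_le_pow_right (by omega) (h _ σ hσ))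
      refine ⟨σ - τ, ?_⟩
      rw [map_sub]
      have := neg_mem hτ
      convert this using 1
      ring
  intro x
  obtain ⟨σ, rfl⟩ := Ideal.Quotient.mk_surjective x
  obtain ⟨τ, hτ⟩ := key N σ (by simp)
  exact ⟨τ, (Ideal.Quotient.mk_eq_mk_iff_sub_mem _ _).2 hτ⟩

/-- The left side tests `φ σ` only against the image of `φ`, which suffices because that image is
everything modulo `Ann f`. -/
theorem mem_Ann_pullback {f : DP k n}
    (h : ∀ j, ∀ σ ∈ mm k n ^ j, φ σ - σ ∈ mm k n ^ (j + 1)) {σ : PS k n} :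
    σ ∈ Ann (pullback φ f) ↔ φ σ ∈ Ann f := by
  simp only [mem_Ann_iff, pullback_apply, map_mul]
  refine ⟨fun hσ τ => ?_, fun hσ τ => hσ _⟩
  obtain ⟨ρ, hρ⟩ := mk_comp_algHom_surjective h (Ideal.Quotient.mk (Ann f) τ)
  have hρ' : φ ρ - τ ∈ Ann f := (Ideal.Quotient.mk_eq_mk_iff_sub_mem _ _).1 hρ
  rw [← hσ ρ, ← sub_eq_zero, ← map_sub, ← sub_mul]
  apply apply_eq_zero_of_mem_Ann
  rw [← neg_sub, neg_mul]
  exact neg_mem (Ideal.mul_mem_right _ _ hρ')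

theorem nonempty_apolar_pullback_algEquiv {f : DP k n}
    (h : ∀ j, ∀ σ ∈ mm k n ^ j, φ σ - σ ∈ mm k n ^ (j + 1)) :
    Nonempty (Apolar (pullback φ f) ≃ₐ[k] Apolar f) := by
  have e : Ann (pullback φ f) = RingHom.ker ((Ideal.Quotient.mkₐ k (Ann f)).comp φ) := by
    ext σ
    rw [mem_Ann_pullback h]
    exact Ideal.Quotient.eq_zero_iff_mem.symm
  exact ⟨(Ideal.quotientEquivAlgOfEq k e).trans
    (Ideal.quotientKerAlgEquivOfSurjective (mk_comp_algHom_surjective h))⟩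

theorem mem_mm_pow_of_algHom_mem
    (h : ∀ j, ∀ σ ∈ mm k n ^ j, φ σ - σ ∈ mm k n ^ (j + 1)) {D : ℕ} {σ : PS k n}
    (hσ : φ σ ∈ mm k n ^ D) : σ ∈ mm k n ^ D := by
  have key : ∀ j ≤ D, σ ∈ mm k n ^ j := by
    intro j
    induction j with
    | zero => simp
    | succ j ih =>
      intro hj
      have := sub_mem (Ideal.pow_le_pow_right hj hσ) (h j σ (ih (by omega)))
      rwa [sub_sub_cancel] at this
  exact key D le_rfl

end Endomorphism

/-! ### Removing the terms of degree at most `m + 1` -/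

theorem Ann_eq_of_contract_eq {f g : DP k n} {u : PS k n} (hu : IsUnit u)
    (h : ∀ τ, f.1 (τ * u) = g.1 τ) : Ann g = Ann f := by
  obtain ⟨v, hv⟩ := hu.exists_right_inv
  ext σ
  simp only [mem_Ann_iff, ← h]
  refine ⟨fun hσ τ => ?_, fun hσ τ => ?_⟩
  · rw [← hσ (τ * v)]
    congr 1
    linear_combination (-τ * σ) * hv
  · rw [mul_right_comm]
    exact hσ _

theorem partGE_apply_of_mem (e : ℕ) (f : DP k n) {σ : PS k n} (hσ : σ ∈ mm k n ^ e) :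
    (partGE e f).1 σ = f.1 σ := by
  change f.1 (dropLow e σ) = f.1 σ
  rw [dropLow_eq_self hσ]

/-- Given `f` with compressed apolar algebra, there are `D_i ∈ 𝔪 ^ (d - m)` such that
`D_i ⌟ f` has as its part of degree `m` a multiple of the part of degree `m` of `α_i ⌟ f`. -/
theorem exists_contract_eq_smul_contract_X {f : DP k n} {d m : ℕ} (hf : HasDegree f d)
    (hd : d ≠ 0) (hm : 2 * m ≤ d) (hA : IsCompressed k n (Apolar f)) (c : k) (i : Fin n) :
    ∃ D ∈ mm k n ^ (d - m), ∀ b : Fin n →₀ ℕ, b.degree = m →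
      f.1 (MvPowerSeries.monomial b 1 * D) =
        c * f.1 (MvPowerSeries.monomial (b + Finsupp.single i 1) 1) := by
  let g : PS k n →ₗ[k] k :=
    c • (f.1 ∘ₗ LinearMap.mulRight k (MvPowerSeries.X i) ∘ₗ (dropLow m - dropLow (m + 1)))
  -- The difference of truncations isolates the homogeneous part of degree `m`, so `g` has degree at
  -- most `m`.
  have hg : ∀ σ, g σ = c * f.1 ((dropLow m σ - dropLow (m + 1) σ) * MvPowerSeries.X i) :=
    fun _ => rfl
  obtain ⟨D, hD, h⟩ := exists_mem_contract_eq_of_isCompressed hf hd hm hA g fun σ hσ => by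
    rw [hg, dropLow_eq_self hσ, dropLow_eq_self (Ideal.pow_le_pow_right (Nat.le_succ m) hσ)]
    simp
  refine ⟨D, hD, fun b hb => ?_⟩
  rw [h, hg, dropLow_monomial, dropLow_monomial, if_pos hb.ge, if_neg (by omega), sub_zero,
    MvPowerSeries.X_def, MvPowerSeries.monomial_mul_monomial, mul_one]

/-- A change of coordinates that removes from `f` all terms of degree `m + 1`, without changing
the terms of higher degree. -/
theorem exists_algHom_pullback_eq_partGE {f : DP k n} {d m : ℕ} (hf : HasDegree f d)
    (hm : 2 * m ≤ d) (hmd : m + 2 ≤ d) (hchar : ((m + 1 : ℕ) : k) ≠ 0)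
    (hA : IsCompressed k n (Apolar f)) :
    ∃ φ : PS k n →ₐ[k] PS k n,
      (∀ j, ∀ σ ∈ mm k n ^ j, φ σ - σ ∈ mm k n ^ (j + 1)) ∧
      ∀ σ ∈ mm k n ^ (m + 1), (pullback φ f).1 σ = (partGE (m + 2) f).1 σ := by
  choose D hD hDf using
    exists_contract_eq_smul_contract_X hf (by omega) hm hA (-((m + 1 : ℕ) : k)⁻¹)
  obtain ⟨t, rfl⟩ : ∃ t, d = m + 1 + t := ⟨d - (m + 1), by omega⟩
  rw [show m + 1 + t - m = t + 1 by omega] at hD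
  obtain ⟨φ, hφ⟩ := exists_algHom_X_add fun i => Ideal.pow_le_self (Nat.succ_ne_zero t) (hD i)
  have hX : ∀ i, φ (MvPowerSeries.X i) - MvPowerSeries.X i ∈ mm k n ^ (t + 1) := fun i => by
    rw [hφ, add_sub_cancel_left]
    exact hD i
  refine ⟨φ, fun j σ hσ => Ideal.pow_le_pow_right (by omega) (algHom_sub_mem_of_X hX hσ), ?_⟩
  refine linearMap_ext_of_monomial (D := m + 1 + t + 1)
    (fun σ hσ => ?_) (fun σ hσ => ?_) fun a ha _ => ?_
  · rw [pullback_apply]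
    exact hf.apply_eq_zero (algHom_map_mem_mm_pow φ hσ)
  · rw [partGE_apply_of_mem _ _ (Ideal.pow_le_pow_right (by omega) hσ)]
    exact hf.apply_eq_zero hσ
  rw [pullback_apply]
  rcases ha.lt_or_eq with ha | ha
  -- In degree at least `m + 2` the change under `φ` has order at least `m + 2 + t = d + 1`.
  · rw [partGE_apply_of_mem _ _ (Ideal.pow_le_pow_right ha (monomial_mem_mm_pow a 1)),
      ← sub_eq_zero, ← map_sub]
    exact hf.apply_eq_zero (Ideal.pow_le_pow_right (by omega)
      (algHom_sub_mem_of_X hX (monomial_mem_mm_pow a 1)))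
  · have h0 : (partGE (m + 2) f).1 (MvPowerSeries.monomial a 1) = 0 := by
      change f.1 (dropLow (m + 2) _) = 0
      rw [dropLow_monomial, if_neg (by omega), map_zero]
    -- The second-order error has order `m + 1 + 2t`, which is at least `d + 1` exactly when `t ≥
    -- 1`; this is `m + 2 ≤ d`.
    have h1 : f.1 _ = 0 := hf.apply_eq_zero
      (Ideal.pow_le_pow_right (by omega) (algHom_monomial_sub_mem hD hφ a))
    have h2 : ∀ i, f.1 (MvPowerSeries.monomial (a - Finsupp.single i 1) (a i : k) * D i) =
        (a i : k) * (-((m + 1 : ℕ) : k)⁻¹ * f.1 (MvPowerSeries.monomial a 1)) := by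
      intro i
      by_cases hi : a i = 0
      · simp [hi]
      · have hle : Finsupp.single i 1 ≤ a := by
          rw [Finsupp.single_le_iff]
          exact Nat.one_le_iff_ne_zero.2 hi
        have hdeg : (a - Finsupp.single i 1).degree = m := by
          have := congrArg Finsupp.degree (tsub_add_cancel_of_le hle)
          rw [map_add, Finsupp.degree_single] at this
          omega
        have h3 := hDf i _ hdeg
        rw [tsub_add_cancel_of_le hle] at h3
        have h4 : (MvPowerSeries.monomial (a - Finsupp.single i 1) (a i : k) : PS k n) =
            (a i : k) • MvPowerSeries.monomial (a - Finsupp.single i 1) 1 := by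
          rw [← map_smul, smul_eq_mul, mul_one]
        rw [← h3, h4, smul_mul_assoc, map_smul, smul_eq_mul]
    have h4 : ∑ i, (a i : k) = ((m + 1 : ℕ) : k) := by
      rw [ha, Finsupp.degree_eq_sum, Nat.cast_sum]
    rw [map_sub, map_sub, map_sum, Finset.sum_congr rfl fun i _ => h2 i, ← Finset.sum_mul, h4,
      neg_mul, mul_neg, mul_inv_cancel_left₀ hchar] at h1
    rw [h0, ← h1]
    ring

/-- The coordinate change leaves a discrepancy of degree at most `m`. It is absorbed by contraction
with a unit, which does not affect the annihilator. -/
theorem nonempty_apolar_algEquiv_partGE {f : DP k n} {d m : ℕ} (hf : HasDegree f d)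
    (hm : 2 * m ≤ d) (hmd : m + 2 ≤ d) (hchar : ((m + 1 : ℕ) : k) ≠ 0)
    (hA : IsCompressed k n (Apolar f)) :
    Nonempty (Apolar f ≃ₐ[k] Apolar (partGE (m + 2) f)) := by
  obtain ⟨φ, h, hφ⟩ := exists_algHom_pullback_eq_partGE hf hm hmd hchar hA
  have hle : Ann (pullback φ f) ≤ mm k n ^ (m + 1) := fun σ hσ =>
    mem_mm_pow_of_algHom_mem h
      (ann_le_of_isCompressed hf (by omega) hm hA ((mem_Ann_pullback h).1 hσ))
  obtain ⟨u, hu⟩ := exists_contract_eq (pullback φ f) (partGE (m + 2) f).1 fun σ hσ => by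
    rw [← hφ σ (hle hσ), apply_eq_zero_of_mem_Ann hσ]
  -- If `u ∈ 𝔪`, then `u ⌟ (f ∘ φ)` has no terms of degree `d`, whereas `f_{≥m+2}` retains those of
  -- `f`.
  have hunit : IsUnit u := by
    by_contra hnu
    obtain ⟨a, rfl, ha⟩ := hf.1
    have hmem : MvPowerSeries.monomial a 1 * u ∈ mm k n ^ (a.degree + 1) := by
      rw [pow_succ]
      exact Ideal.mul_mem_mul (monomial_mem_mm_pow a 1) ((IsLocalRing.mem_maximalIdeal u).2 hnu)
    have h1 := hu (MvPowerSeries.monomial a 1)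
    rw [partGE_apply_of_mem _ _ (Ideal.pow_le_pow_right hmd (monomial_mem_mm_pow a 1)),
      pullback_apply, hf.apply_eq_zero (algHom_map_mem_mm_pow φ hmem)] at h1
    exact ha h1.symm
  obtain ⟨e⟩ := nonempty_apolar_pullback_algEquiv (f := f) h
  exact ⟨e.symm.trans (Ideal.quotientEquivAlgOfEq k (Ann_eq_of_contract_eq hunit hu).symm)⟩

end Apolarity

end

theorem mainTheorem5 {k : Type*} [Field k] [IsAlgClosed k] (n d : ℕ) (hd : 3 ≤ d)
    (hchar : ringChar k = 0 ∨ d < ringChar k)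
    (f : Apolarity.DP k n) (hf : Apolarity.HasDegree f d)
    (hA : Apolarity.IsCompressed k n (Apolarity.Apolar f)) :
    Nonempty (Apolarity.Apolar f ≃ₐ[k] Apolarity.Apolar (Apolarity.partGE (d / 2 + 2) f)) := by
  refine Apolarity.nonempty_apolar_algEquiv_partGE hf (by omega) (by omega) (fun h => ?_) hA
  rw [ringChar.spec] at h
  rcases hchar with h0 | h0
  · rw [h0, zero_dvd_iff] at h
    omega
  · have := Nat.le_of_dvd (Nat.succ_pos _) h
    omega
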